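/- **Setting.** Let $n\ge 0$ be an integer. For $\mathbf q=(\mathbf q_0,\dots,\mathbf q_{n-1})^t\in\mathbb H^n$ write $\mathbf q_l=x_{4l}+\mathbf i x_{4l+1}+\mathbf j x_{4l+2}+\mathbf k x_{4l+3}$. For a complex function $f$ put $$\begin{pmatrix}\nabla_{(2l)0'}f&\nabla_{(2l)1'}f\\ \nabla_{(2l+1)0'}f&\nabla_{(2l+1)1'}f\end{pmatrix}=\frac12\begin{pmatrix}\partial_{x_{4l}}f+\mathbf i\,\partial_{x_{4l+1}}f&-\partial_{x_{4l+2}}f-\mathbf i\,\partial_{x_{4l+3}}f\\ \partial_{x_{4l+2}}f-\mathbf i\,\partial_{x_{4l+3}}f&\partial_{x_{4l}}f-\mathbf i\,\partial_{x_{4l+1}}f\end{pmatrix}.$$ Let $\omega^0,\dots,\omega^{2n-1}$ be Grassmann variables, $d_{A'}(f_{\mathbf A}\omega^{\mathbf A})=\sum_A\nabla_{AA'}f_{\mathbf A}\,\omega^A\omega^{\mathbf A}$ for $A'=0',1'$, let $\triangle u=d_{0'}d_{1'}u$ be the Baston operator, and define the quaternionic Monge–Ampère operator $M(u)$ by $(\triangle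 u)^n=M(u)\,\Omega_{2n}$, where $\Omega_{2n}=\omega^0\wedge\omega^1\wedge\dots\wedge\omega^{2n-1}$. Let ${\rm SL}(n+1,\mathbb H)$ be the group of invertible quaternionic $(n+1)\times(n+1)$ matrices whose complexification, a complex $(2n+2)\times(2n+2)$ matrix, has determinant $1$. For $g\in{\rm SL}(n+1,\mathbb H)$ write $g^{-1}=\begin{pmatrix}\mathbf a&\mathbf b\\ \mathbf c&\mathbf d\end{pmatrix}$ with $\mathbf a\in\mathbb H$ and $\mathbf d$ of size $n\times n$, and, where $\mathbf a+\mathbf b\mathbf q\neq0$, $$J_1(g^{-1},\mathbf q)=\mathbf a+\mathbf b\mathbf q,\qquad g^{-1}.\mathbf q=(\mathbf c+\mathbf d\mathbf q)(\mathbf a+\mathbf b\mathbf q)^{-1},\qquad (\pi(g)u)(\mathbf q)=|\mathbf a+\mathbf b\mathbf q|^{-2}\,u(g^{-1}.\mathbf q).$$ A locally quaternionic projective flat manifold is a topological space $X$ with charts $\phi_\alpha:U_\alpha\to\mathbb H^n$ (homeomorphisms from open sets $U_\alpha$, which cover $X$, onto open sets) and elements $g_{\alpha\beta}\in{\rm SL}(n+1,\mathbb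 H)$ such that, for every $p\in U_\alpha\cap U_\beta$, $J_1(g_{\alpha\beta}^{-1},\phi_\alpha(p))\ne0$ and $\phi_\beta(p)=g_{\alpha\beta}^{-1}.\phi_\alpha(p)$. A $C^2$ section $u$ of the line bundle $\mathbb R[-1]$ over $X$ is a family of real $C^2$ functions $u_\alpha$ on $\phi_\alpha(U_\alpha)$ with $u_\alpha(\mathbf q)=(\pi(g_{\alpha\beta})u_\beta)(\mathbf q)$ for all $\mathbf q\in\phi_\alpha(U_\alpha\cap U_\beta)$. **Proposition.** 1. Let $g\in{\rm SL}(n+1,\mathbb H)$ and $\mathbf q\in\mathbb H^n$ with $\mathbf a+\mathbf b\mathbf q\ne0$, and let $u$ be a real function that is $C^2$ near $g^{-1}.\mathbf q$. Then $$M(\pi(g)u)(\mathbf q)=\frac{1}{|\mathbf a+\mathbf b\mathbf q|^{4n+2}}\;M(u)(g^{-1}.\mathbf q),$$ and, if $u(g^{-1}.\mathbf q)\neq0$, $$\frac{M(\pi(g)u)}{(\pi(g)u)^{2n+1}}(\mathbf q)=\frac{M(u)}{u^{2n+1}}(g^{-1}.\mathbf q).$$ 2. Let $u$ be a $C^2$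 section of $\mathbb R[-1]$ over a locally quaternionic projective flat manifold $X$. Then the local expressions $\dfrac{M(u_\alpha)}{u_\alpha^{2n+1}}\circ\phi_\alpha$ agree on overlaps of charts, so that $M(u)/u^{2n+1}$ is a well-defined function on the open set where $u\ne0$. -/

import Mathlib

noncomputable section

namespace QuatProj

/-! ### The group `SL(n+1, ℍ)` and its fractional linear action on `ℍⁿ` -/

/-- Quaternionic affine space `ℍⁿ` (column vectors), a real normed space of dimension `4n`. -/
abbrev HSpace (n : ℕ) : Type := Fin n → Quaternion ℝ

/-- The embedding of `ℍ` into the complex `2 × 2` matrices,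
`x₀ + i x₁ + j x₂ + k x₃ ↦ !![x₀ - i x₁, -x₂ + i x₃; x₂ + i x₃, x₀ + i x₁]`. -/
def tauScalar : Quaternion ℝ →+* Matrix (Fin 2) (Fin 2) ℂ where
  toFun q := !![(q.re : ℂ) - Complex.I * q.imI, -(q.imJ : ℂ) + Complex.I * q.imK;
    (q.imJ : ℂ) + Complex.I * q.imK, (q.re : ℂ) + Complex.I * q.imI]
  map_one' := by
    ext i j
    fin_cases i <;> fin_cases j <;>
      simp [Quaternion.re_one, Quaternion.imI_one, Quaternion.imJ_one, Quaternion.imK_one]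
  map_mul' p q := by
    ext i j
    fin_cases i <;> fin_cases j <;> simp [Complex.ext_iff] <;> constructor <;> ring
  map_zero' := by
    ext i j
    fin_cases i <;> fin_cases j <;>
      simp [Quaternion.re_zero, Quaternion.imI_zero, Quaternion.imJ_zero, Quaternion.imK_zero]
  map_add' p q := by
    ext i j
    fin_cases i <;> fin_cases j <;> simp [Complex.ext_iff] <;> ring

/-- The embedding `τ` of quaternionic `m × m` matrices into complex `2m × 2m` matrices, replacing
every entry by its `2 × 2` block. -/
def tau (m : ℕ) : Matrix (Fin m) (Fin m) (Quaternion ℝ) →+*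
    Matrix (Fin m × Fin 2) (Fin m × Fin 2) ℂ :=
  (Matrix.compRingEquiv (Fin m) (Fin 2) ℂ).toRingHom.comp tauScalar.mapMatrix

/-- The group `SL(n+1, ℍ)`: invertible quaternionic matrices `g` with `det τ(g) = 1`. -/
def SLH (n : ℕ) : Subgroup (Matrix (Fin (n + 1)) (Fin (n + 1)) (Quaternion ℝ))ˣ :=
  MonoidHom.ker ((Matrix.detMonoidHom.comp (tau (n + 1)).toMonoidHom).comp (Units.coeHom _))

/-- The `(i, j)` entry of an element of `SL(n+1, ℍ)`. -/
def entry {n : ℕ} (h : SLH n) (i j : Fin (n + 1)) : Quaternion ℝ :=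
  ((h : (Matrix (Fin (n + 1)) (Fin (n + 1)) (Quaternion ℝ))ˣ) :
    Matrix (Fin (n + 1)) (Fin (n + 1)) (Quaternion ℝ)) i j

/-- `J₁(h, q) = a + b q` for `h = (a b; c d)` with `a` of size `1 × 1`, `b` of size `1 × n`,
`c` of size `n × 1` and `d` of size `n × n`. -/
def J₁ {n : ℕ} (h : SLH n) (q : HSpace n) : Quaternion ℝ :=
  entry h 0 0 + ∑ j : Fin n, entry h 0 j.succ * q j

/-- The quaternionic fractional linear transformation `h.q = (c + d q) (a + b q)⁻¹` for
`h = (a b; c d)`; it is only meaningful where `J₁ h q = a + b q ≠ 0`. -/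
def act {n : ℕ} (h : SLH n) (q : HSpace n) : HSpace n := fun i =>
  (entry h i.succ 0 + ∑ j : Fin n, entry h i.succ j.succ * q j) * (J₁ h q)⁻¹

/-- The weighted action of `g` on functions, for weight `[-1]`:
`q ↦ |a + b q|⁻² u(g⁻¹.q)`, where `g⁻¹ = (a b; c d)`. -/
def weightedAct {n : ℕ} (g : SLH n) (u : HSpace n → ℝ) : HSpace n → ℝ := fun q =>
  (‖J₁ g⁻¹ q‖ ^ 2)⁻¹ * u (act g⁻¹ q)

/-! ### The Baston operator and the quaternionic Monge–Ampère operator -/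

/-- The real unit quaternions `1, i, j, k`. -/
def unitQ : Fin 4 → Quaternion ℝ := ![⟨1, 0, 0, 0⟩, ⟨0, 1, 0, 0⟩, ⟨0, 0, 1, 0⟩, ⟨0, 0, 0, 1⟩]

/-- The real partial derivative `∂/∂x_{4l+s}`, where `q_l = x_{4l} + i x_{4l+1} + j x_{4l+2} +
k x_{4l+3}`. -/
def partialX {n : ℕ} (l : Fin n) (s : Fin 4) (f : HSpace n → ℂ) : HSpace n → ℂ := fun q =>
  fderiv ℝ f q (Pi.single l (unitQ s))

/-- The index set of the Grassmann variables `ω⁰, …, ω^{2n-1}`; the pair `(l, e)` stands for the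
index `A = 2l + e`. -/
abbrev Idx (n : ℕ) : Type := Fin n × Fin 2

/-- The complex first-order operators `∇_{AA'}`, `A = 2l + e`, `A' = 0', 1'`. -/
def nabla {n : ℕ} (A : Idx n) (A' : Fin 2) (f : HSpace n → ℂ) : HSpace n → ℂ := fun q =>
  (1 / 2 : ℂ) *
    (!![partialX A.1 0 f q + Complex.I * partialX A.1 1 f q,
          -partialX A.1 2 f q - Complex.I * partialX A.1 3 f q;
        partialX A.1 2 f q - Complex.I * partialX A.1 3 f q,
          partialX A.1 0 f q - Complex.I * partialX A.1 1 f q] A.2 A')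

/-- The Grassmann algebra `∧ ℂ^{2n}`. -/
abbrev Grassmann (n : ℕ) : Type := ExteriorAlgebra ℂ (Idx n → ℂ)

/-- A `∧^k ℂ^{2n}`-valued function `f_{A₁…A_k} ω^{A₁} ⋯ ω^{A_k}`, given by its coefficients. -/
abbrev FormField (n k : ℕ) : Type := (Fin k → Idx n) → HSpace n → ℂ

/-- The value `∑ f_{A₁…A_k}(q) ω^{A₁} ⋯ ω^{A_k}` in the Grassmann algebra. -/
def FormField.value {n k : ℕ} (F : FormField n k) (q : HSpace n) : Grassmann n :=
  ∑ I : Fin k → Idx n, F I q • ExteriorAlgebra.ιMulti ℂ k fun j => (Pi.single (I j) 1 : Idx n → ℂ)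

/-- `d_{A'} (f_𝐀 ω^𝐀) = ∇_{AA'} f_𝐀 ω^A ω^𝐀`. -/
def dOp {n k : ℕ} (A' : Fin 2) (F : FormField n k) : FormField n (k + 1) := fun I =>
  nabla (I 0) A' (F (Fin.tail I))

/-- The Baston operator `△u = d_{0'} d_{1'} u`. -/
def baston {n : ℕ} (u : HSpace n → ℝ) (q : HSpace n) : Grassmann n :=
  (dOp 0 (dOp 1 (fun _ x => (u x : ℂ) : FormField n 0))).value q

/-- The standard basis `ω⁰, ω¹, …, ω^{2n-1}` of `ℂ^{2n}`, listed in this order. -/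
def omegaBasis (n : ℕ) : Module.Basis (Fin (n * 2)) ℂ (Idx n → ℂ) :=
  (Pi.basisFun ℂ (Idx n)).reindex finProdFinEquiv

/-- `Ω_{2n} = ω⁰ ∧ ω¹ ∧ ⋯ ∧ ω^{2n-1}`. -/
def Omega (n : ℕ) : Grassmann n := ExteriorAlgebra.ιMulti ℂ (n * 2) (omegaBasis n)

/-- The linear functional on `∧ ℂ^{2n}` sending an element to the coefficient of `Ω_{2n}` in its
component of degree `2n`. -/
def topCoeff (n : ℕ) : Grassmann n →ₗ[ℂ] ℂ :=
  ExteriorAlgebra.liftAlternating (Pi.single (n * 2) (omegaBasis n).det)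

/-- The quaternionic Monge–Ampère operator `M(u)`, determined by `(△u)^n = M(u) Ω_{2n}`
(see `baston_pow_eq`). -/
def mongeAmpere {n : ℕ} (u : HSpace n → ℝ) (q : HSpace n) : ℂ := topCoeff n (baston u q ^ n)

theorem topCoeff_Omega (n : ℕ) : topCoeff n (Omega n) = 1 := by
  rw [topCoeff, Omega, ExteriorAlgebra.liftAlternating_apply_ιMulti, Pi.single_eq_same]
  exact (omegaBasis n).det_self

theorem ιMulti_eq_smul_Omega (n : ℕ) (v : Fin (n * 2) → Idx n → ℂ) :
    ExteriorAlgebra.ιMulti ℂ (n * 2) v = (omegaBasis n).det v • Omega n := by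
  have h : ExteriorAlgebra.ιMulti ℂ (n * 2) =
      (LinearMap.toSpanSingleton ℂ (Grassmann n) (Omega n)).compAlternatingMap
        (omegaBasis n).det := by
    refine (omegaBasis n).ext_alternating fun s hs => ?_
    let σ : Equiv.Perm (Fin (n * 2)) := Equiv.ofBijective s (Finite.injective_iff_bijective.1 hs)
    have e : (fun i => omegaBasis n (s i)) = (omegaBasis n) ∘ σ := rfl
    rw [e, AlternatingMap.map_perm, AlternatingMap.map_perm, LinearMap.compAlternatingMap_apply,
      (omegaBasis n).det_self]
    simp [Omega]
  simpa using congrArg (fun f => f v) h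

theorem exteriorPower_top_eq (n : ℕ) (x : Grassmann n) (hx : x ∈ ⋀[ℂ]^(n * 2) (Idx n → ℂ)) :
    x = topCoeff n x • Omega n := by
  rw [← ExteriorAlgebra.ιMulti_span_fixedDegree] at hx
  induction hx using Submodule.span_induction with
  | mem x hx =>
    obtain ⟨v, rfl⟩ := hx
    rw [ιMulti_eq_smul_Omega, map_smul, topCoeff_Omega, smul_eq_mul, mul_one]
  | zero => simp
  | add x y _ _ hx hy => rw [map_add, add_smul, ← hx, ← hy]
  | smul a x _ hx => rw [map_smul, smul_assoc, ← hx]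

/-- The defining property `(△u)^n = M(u) Ω_{2n}` of the quaternionic Monge–Ampère operator. -/
theorem baston_pow_eq {n : ℕ} (u : HSpace n → ℝ) (q : HSpace n) :
    baston u q ^ n = mongeAmpere u q • Omega n := by
  apply exteriorPower_top_eq
  have h2 : baston u q ∈ ⋀[ℂ]^2 (Idx n → ℂ) :=
    Submodule.sum_mem _ fun I _ => Submodule.smul_mem _ _
      (ExteriorAlgebra.ιMulti_range ℂ 2 (Set.mem_range_self _))
  have h := Submodule.pow_mem_pow _ h2 n
  rwa [← pow_mul, mul_comm] at h

/-! ### Locally quaternionic projective flat manifolds and sections of `ℝ[-1]` -/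

/-- A locally quaternionic projective flat structure on `M`: an atlas of charts
`φ_α : U_α → ℍⁿ` with transition maps `φ_β ∘ φ_α⁻¹ = (q ↦ g_{αβ}⁻¹.q)` on `φ_α(U_α ∩ U_β)`, for
elements `g_{αβ}` of `SL(n+1, ℍ)` acting by fractional linear transformations. -/
structure FlatStructure (n : ℕ) (M : Type*) [TopologicalSpace M] (ι : Type*) where
  /-- the charts `φ_α` -/
  chart : ι → OpenPartialHomeomorph M (HSpace n)
  /-- the elements `g_{αβ}` -/
  trans : ι → ι → SLH n
  cover : ∀ p : M, ∃ α, p ∈ (chart α).source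
  transition : ∀ α β p, p ∈ (chart α).source → p ∈ (chart β).source →
    J₁ (trans α β)⁻¹ (chart α p) ≠ 0 ∧ chart β p = act (trans α β)⁻¹ (chart α p)

/-- A section of class `C²` of the line bundle `ℝ[-1]`, which is glued from the trivial bundles
`φ_α(U_α) × ℝ` by `t_α = |J₁(g_{αβ}⁻¹, q_α)|⁻² t_β` for `g_{αβ}⁻¹.q_α = q_β`: a family of local
`C²` functions `u_α` on `φ_α(U_α)` with `u_α(q_α) = |J₁(g_{αβ}⁻¹, q_α)|⁻² u_β(g_{αβ}⁻¹.q_α)`.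
The values of `u_α` outside `φ_α(U_α)` carry no meaning. -/
structure FlatStructure.DensitySection {n : ℕ} {M : Type*} [TopologicalSpace M] {ι : Type*}
    (X : FlatStructure n M ι) where
  /-- the local representatives `u_α` -/
  loc : ι → HSpace n → ℝ
  contDiffOn : ∀ α, ContDiffOn ℝ 2 (loc α) (X.chart α).target
  glue : ∀ α β p, p ∈ (X.chart α).source → p ∈ (X.chart β).source →
    loc α (X.chart α p) = weightedAct (X.trans α β) (loc β) (X.chart α p)

end QuatProj

end

noncomputable section

namespace QuatProj

open scoped Quaternion

/-! ### Derivatives of the fractional linear action -/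

/-! Write h = g⁻¹, J = a + bq, L(w) = J⁻¹bw and D = d - (h.q)b. The derivative of q ↦ h.q is w ↦
DwJ⁻¹, and that of |J|⁻² is -2 Re L(w) |J|⁻². Hence the Hessian of |J|⁻² u(h.q) is |J|⁻² times the
sum of a pulled-back Hessian of u, a gradient term and a multiple of u (`fderiv_fderiv_weight_mul`).

The operators ∇_{AA'} are dual to the entries of τ(v), so △ reads off the coefficients H_{A0',B1'}
of the Hessian and kills whatever is symmetric in A, B. The gradient term and the multiple of u are
symmetric in this sense; this is where the weight |J|⁻² matters (`bastonForm_gradient_term`,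
`bastonForm_value_term`). In the remaining term τ(DvJ⁻¹) = τ(D)τ(v)τ(J⁻¹): the left factor
substitutes τ(D) into the Grassmann variables, and the right factor enters only through det τ(J⁻¹) =
|J|⁻². So △ of the new function is |J|⁻⁴ times τ(D) acting on △u (`baston_weight_mul`).

The n-th power has top degree, so τ(D) multiplies it by det τ(D). Clearing the first column of h by
unipotent matrices gives |J|² det τ(D) = det τ(h) = 1 (`det_tau_actMatrix`). The total factor is
|J|⁻⁴ⁿ|J|⁻², which is also that of u^{2n+1}. Invariance of the quotient and gluing follow. -/

/-- The linear part `w ↦ b w` of the affine map `q ↦ a + b q`. -/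
def linJ {n : ℕ} (h : SLH n) (w : HSpace n) : ℍ[ℝ] := ∑ j : Fin n, entry h 0 j.succ * w j

/-- The logarithmic derivative `w ↦ (a + b q)⁻¹ b w` of `a + b q`. -/
def logJ {n : ℕ} (h : SLH n) (q w : HSpace n) : ℍ[ℝ] := (J₁ h q)⁻¹ * linJ h w

/-- The quaternionic matrix `d - (h.q) b`. -/
def actMatrix {n : ℕ} (h : SLH n) (q : HSpace n) : Matrix (Fin n) (Fin n) ℍ[ℝ] :=
  fun i j => entry h i.succ j.succ - act h q i * entry h 0 j.succ

/-- The derivative `w ↦ (d - (h.q) b) w (a + b q)⁻¹` of `q ↦ h.q`. -/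
def dAct {n : ℕ} (h : SLH n) (q w : HSpace n) : HSpace n :=
  fun i => (∑ j, actMatrix h q i j * w j) * (J₁ h q)⁻¹

theorem dAct_add {n : ℕ} (h : SLH n) (q v w : HSpace n) :
    dAct h q (v + w) = dAct h q v + dAct h q w := by
  ext1 i
  simp [dAct, mul_add, Finset.sum_add_distrib, add_mul]

theorem dAct_smul {n : ℕ} (h : SLH n) (q : HSpace n) (r : ℝ) (w : HSpace n) :
    dAct h q (r • w) = r • dAct h q w := by
  ext1 i
  simp [dAct, ← Finset.smul_sum]

theorem hasLineDerivAt_J₁ {n : ℕ} (h : SLH n) (q w : HSpace n) :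
    HasLineDerivAt ℝ (J₁ h) (linJ h w) q w := by
  have : ∀ j : Fin n, HasDerivAt (fun t : ℝ => entry h 0 j.succ * (q j + t • w j))
      (entry h 0 j.succ * w j) 0 := fun j => by
    simpa using (((hasDerivAt_id (0 : ℝ)).smul_const (w j)).const_add (q j)).const_mul
      (entry h 0 j.succ)
  exact (HasDerivAt.fun_sum fun j _ => this j).const_add _

theorem hasLineDerivAt_J₁_inv {n : ℕ} (h : SLH n) (q w : HSpace n) (hq : J₁ h q ≠ 0) :
    HasLineDerivAt ℝ (fun x => (J₁ h x)⁻¹) (-(logJ h q w * (J₁ h q)⁻¹)) q w := by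
  have h1 := hasLineDerivAt_J₁ h q w
  have h2 : HasFDerivAt (Inv.inv : ℍ[ℝ] → ℍ[ℝ]) _ (J₁ h (q + (0 : ℝ) • w)) :=
    hasFDerivAt_inv' (𝕜 := ℝ) (by simpa using hq)
  refine HasDerivAt.congr_deriv (h2.comp_hasDerivAt (0 : ℝ) h1) ?_
  simp [logJ]

theorem hasLineDerivAt_logJ {n : ℕ} (h : SLH n) (q v w : HSpace n) (hq : J₁ h q ≠ 0) :
    HasLineDerivAt ℝ (fun x => logJ h x w) (-(logJ h q v * logJ h q w)) q v := by
  have h1 : HasDerivAt _ _ _ := hasLineDerivAt_J₁_inv h q v hq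
  refine HasDerivAt.congr_deriv (h1.mul_const (linJ h w)) ?_
  simp [logJ, mul_assoc]

/-- Product rule: dwJ⁻¹ - (c + dq)J⁻¹ · bw · J⁻¹, where (c + dq)J⁻¹ is again h.q, so the two terms
combine into one matrix acting from the left. -/
theorem hasLineDerivAt_act {n : ℕ} (h : SLH n) (q w : HSpace n) (hq : J₁ h q ≠ 0) :
    HasLineDerivAt ℝ (act h) (dAct h q w) q w := by
  refine hasDerivAt_pi.2 fun i => ?_
  have h0 : ∀ j : Fin n, HasDerivAt (fun t : ℝ => entry h i.succ j.succ * (q j + t • w j))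
      (entry h i.succ j.succ * w j) 0 := fun j => by
    simpa using (((hasDerivAt_id (0 : ℝ)).smul_const (w j)).const_add (q j)).const_mul
      (entry h i.succ j.succ)
  have h1 := (HasDerivAt.fun_sum fun j (_ : j ∈ Finset.univ) => h0 j).const_add
    (entry h i.succ 0)
  have h2 : HasDerivAt _ _ _ := hasLineDerivAt_J₁_inv h q w hq
  refine HasDerivAt.congr_deriv (h1.mul h2) ?_
  simp only [dAct, actMatrix, logJ, linJ, act, sub_mul, Finset.sum_sub_distrib, mul_assoc,
    ← Finset.mul_sum, zero_smul, add_zero]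
  noncomm_ring

/-- Differentiating D contributes -(DvJ⁻¹)bwJ⁻¹ = -D(vL(w))J⁻¹, and differentiating J⁻¹ contributes
-D(wL(v))J⁻¹. Both are again values of the first derivative. -/
theorem hasLineDerivAt_dAct {n : ℕ} (h : SLH n) (q v w : HSpace n) (hq : J₁ h q ≠ 0) :
    HasLineDerivAt ℝ (fun x => dAct h x w)
      (-dAct h q ((fun j => v j * logJ h q w) + fun j => w j * logJ h q v)) q v := by
  refine hasDerivAt_pi.2 fun i => ?_
  have h1 : HasDerivAt _ _ _ := hasDerivAt_pi.1 (hasLineDerivAt_act h q v hq) i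
  have h2 : HasDerivAt _ _ _ := hasLineDerivAt_J₁_inv h q v hq
  have h3 := HasDerivAt.fun_sum fun j (_ : j ∈ Finset.univ) =>
    ((h1.mul_const (entry h 0 (Fin.succ j))).const_sub (entry h i.succ (Fin.succ j))).mul_const
      (w j)
  refine HasDerivAt.congr_deriv (h3.mul h2) ?_
  rw [dAct_add]
  simp only [dAct, actMatrix, logJ, linJ, Pi.neg_apply, Pi.add_apply, zero_smul, add_zero, neg_mul,
    mul_neg, Finset.sum_neg_distrib, neg_add, ← Finset.sum_mul, ← mul_assoc]
  simp only [← Finset.mul_sum, mul_assoc]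

/-- The derivative of |J|² is 2 Re(J̄bw), and J̄ = |J|²J⁻¹. -/
theorem hasLineDerivAt_weight {n : ℕ} (h : SLH n) (q w : HSpace n) (hq : J₁ h q ≠ 0) :
    HasLineDerivAt ℝ (fun x => (‖J₁ h x‖ ^ 2)⁻¹)
      (-((‖J₁ h q‖ ^ 2)⁻¹ * (2 * (logJ h q w).re))) q w := by
  have h1 : HasDerivAt _ _ _ := hasLineDerivAt_J₁ h q w
  have h2 := h1.norm_sq.inv (by simpa using hq)
  refine HasDerivAt.congr_deriv h2 ?_
  have h3 : (J₁ h q)⁻¹ = (‖J₁ h q‖ ^ 2)⁻¹ • star (J₁ h q) := by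
    rw [Quaternion.inv_def, Quaternion.normSq_eq_norm_mul_self, sq]
  have h4 : ‖J₁ h q‖ ≠ 0 := by simpa using hq
  simp only [zero_smul, add_zero, Quaternion.inner_def, logJ, h3, smul_mul_assoc,
    Quaternion.re_smul, smul_eq_mul]
  have h5 : (star (J₁ h q) * linJ h w).re = (J₁ h q * star (linJ h w)).re := by
    simp only [Quaternion.re_mul, Quaternion.re_star, Quaternion.imI_star, Quaternion.imJ_star,
      Quaternion.imK_star]
    ring
  rw [h5]
  field_simp

/-! ### Smoothness and Hessian of the weighted pullback. -/

theorem contDiff_J₁ {n : ℕ} (h : SLH n) : ContDiff ℝ 2 (J₁ h) := by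
  unfold J₁
  fun_prop

theorem contDiffAt_J₁_inv {n : ℕ} (h : SLH n) (q : HSpace n) (hq : J₁ h q ≠ 0) :
    ContDiffAt ℝ 2 (fun x => (J₁ h x)⁻¹) q := by
  have h1 := contDiffAt_ringInverse ℝ (n := 2) (Units.mk0 _ hq)
  rw [Ring.inverse_eq_inv'] at h1
  exact h1.comp q (contDiff_J₁ h).contDiffAt

theorem contDiffAt_act {n : ℕ} (h : SLH n) (q : HSpace n) (hq : J₁ h q ≠ 0) :
    ContDiffAt ℝ 2 (act h) q := by
  refine contDiffAt_pi.2 fun i => ContDiffAt.mul ?_ (contDiffAt_J₁_inv h q hq)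
  fun_prop

theorem contDiffAt_weight_mul {n : ℕ} (h : SLH n) (u : HSpace n → ℝ) (q : HSpace n)
    (hq : J₁ h q ≠ 0) (hu : ContDiffAt ℝ 2 u (act h q)) :
    ContDiffAt ℝ 2 (fun x => (‖J₁ h x‖ ^ 2)⁻¹ * u (act h x)) q := by
  refine ContDiffAt.mul (ContDiffAt.inv ?_ (by simpa using hq)) (hu.comp q (contDiffAt_act h q hq))
  exact (contDiff_J₁ h).contDiffAt.norm_sq ℝ

theorem eventually_J₁_ne_zero {n : ℕ} (h : SLH n) (q : HSpace n) (hq : J₁ h q ≠ 0) :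
    ∀ᶠ x in nhds q, J₁ h x ≠ 0 :=
  (contDiff_J₁ h).continuous.continuousAt.eventually_ne hq

theorem fderiv_weight_mul {n : ℕ} (h : SLH n) (u : HSpace n → ℝ) (q w : HSpace n)
    (hq : J₁ h q ≠ 0) (hu : ContDiffAt ℝ 2 u (act h q)) :
    fderiv ℝ (fun x => (‖J₁ h x‖ ^ 2)⁻¹ * u (act h x)) q w =
      (‖J₁ h q‖ ^ 2)⁻¹ * (fderiv ℝ u (act h q) (dAct h q w) -
        2 * (logJ h q w).re * u (act h q)) := by
  have h1 := ((contDiffAt_weight_mul h u q hq hu).differentiableAt (by simp)).lineDeriv_eq_fderiv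
    (v := w)
  rw [← h1]
  apply HasLineDerivAt.lineDeriv
  have hu' : HasFDerivAt u (fderiv ℝ u (act h q)) (act h (q + (0 : ℝ) • w)) := by
    simpa using (hu.differentiableAt (by simp)).hasFDerivAt
  have h2 : HasDerivAt _ _ _ := hasLineDerivAt_act h q w hq
  have h3 : HasDerivAt _ _ _ := hasLineDerivAt_weight h q w hq
  refine HasDerivAt.congr_deriv (h3.mul (hu'.comp_hasDerivAt (0 : ℝ) h2)) ?_
  simp
  ring

theorem hasDerivAt_mul_sub_two_mul {a b c d : ℝ → ℝ} {a' b' c' d' t : ℝ} (ha : HasDerivAt a a' t)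
    (hb : HasDerivAt b b' t) (hc : HasDerivAt c c' t) (hd : HasDerivAt d d' t) :
    HasDerivAt (fun s => a s * (b s - 2 * c s * d s))
      (a' * (b t - 2 * c t * d t) + a t * (b' - (2 * c' * d t + 2 * c t * d'))) t :=
  ha.mul (hb.sub ((hc.const_mul 2).mul hd))

theorem hasDerivAt_fderiv_apply {E : Type*} [NormedAddCommGroup E] [NormedSpace ℝ E] {u : E → ℝ}
    {γ δ : ℝ → E} {γ' δ' : E} {t : ℝ} {K : E →L[ℝ] E →L[ℝ] ℝ}
    (hu : HasFDerivAt (fderiv ℝ u) K (γ t)) (hγ : HasDerivAt γ γ' t) (hδ : HasDerivAt δ δ' t) :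
    HasDerivAt (fun s => fderiv ℝ u (γ s) (δ s)) (K γ' (δ t) + fderiv ℝ u (γ t) δ') t :=
  (hu.comp_hasDerivAt t hγ).clm_apply hδ

theorem hasDerivAt_re {γ : ℝ → ℍ[ℝ]} {γ' : ℍ[ℝ]} {t : ℝ} (hγ : HasDerivAt γ γ' t) :
    HasDerivAt (fun s => (γ s).re) γ'.re t := by
  let reL : ℍ[ℝ] →L[ℝ] ℝ := LinearMap.toContinuousLinearMap
    { toFun := fun x => x.re, map_add' := fun _ _ => rfl, map_smul' := fun _ _ => rfl }
  exact (reL.hasFDerivAt (x := γ t)).comp_hasDerivAt t hγ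

theorem hasLineDerivAt_fderiv_weight_mul {n : ℕ} (h : SLH n) (u : HSpace n → ℝ) (q v w : HSpace n)
    (hq : J₁ h q ≠ 0) (hu : ContDiffAt ℝ 2 u (act h q)) :
    HasLineDerivAt ℝ (fun x => (‖J₁ h x‖ ^ 2)⁻¹ * (fderiv ℝ u (act h x) (dAct h x w) -
        2 * (logJ h x w).re * u (act h x)))
      ((‖J₁ h q‖ ^ 2)⁻¹ * (fderiv ℝ (fderiv ℝ u) (act h q) (dAct h q v) (dAct h q w) -
        fderiv ℝ u (act h q) (dAct h q ((fun j => v j * logJ h q w) + (fun j => w j * logJ h q v) +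
          (2 * (logJ h q v).re) • w + (2 * (logJ h q w).re) • v)) +
        u (act h q) * (2 * (logJ h q v).re * (2 * (logJ h q w).re) +
          2 * (logJ h q v * logJ h q w).re))) q v := by
  have hu0 : HasFDerivAt u (fderiv ℝ u (act h q)) (act h (q + (0 : ℝ) • v)) := by
    rw [zero_smul, add_zero]
    exact (hu.differentiableAt (by simp)).hasFDerivAt
  have hu1 : HasFDerivAt (fderiv ℝ u) (fderiv ℝ (fderiv ℝ u) (act h q))
      (act h (q + (0 : ℝ) • v)) := by
    rw [zero_smul, add_zero]
    exact ((hu.fderiv_right (m := 1) (by norm_num)).differentiableAt (by simp)).hasFDerivAt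
  have h2 : HasDerivAt (fun t : ℝ => act h (q + t • v)) (dAct h q v) 0 :=
    hasLineDerivAt_act h q v hq
  have h3 : HasDerivAt _ _ _ := hasLineDerivAt_weight h q v hq
  have h4 : HasDerivAt (fun t : ℝ => dAct h (q + t • v) w)
      (-dAct h q ((fun j => v j * logJ h q w) + fun j => w j * logJ h q v)) 0 :=
    hasLineDerivAt_dAct h q v w hq
  have h5 : HasDerivAt _ _ _ := hasLineDerivAt_logJ h q v w hq
  have h6 : HasDerivAt (fun t : ℝ => fderiv ℝ u (act h (q + t • v)) (dAct h (q + t • v) w))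
      (fderiv ℝ (fderiv ℝ u) (act h q) (dAct h q v) (dAct h q w) + fderiv ℝ u (act h q)
        (-dAct h q ((fun j => v j * logJ h q w) + fun j => w j * logJ h q v))) 0 := by
    have h' := hasDerivAt_fderiv_apply (u := u) hu1 h2 h4
    simp only [zero_smul, add_zero] at h'
    exact h'
  have h7 : HasDerivAt (fun t : ℝ => (logJ h (q + t • v) w).re)
      (-(logJ h q v * logJ h q w)).re 0 :=
    hasDerivAt_re h5
  have h8 : HasDerivAt (fun t : ℝ => u (act h (q + t • v))) (fderiv ℝ u (act h q) (dAct h q v)) 0 :=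
    hu0.comp_hasDerivAt (0 : ℝ) h2
  refine HasDerivAt.congr_deriv (hasDerivAt_mul_sub_two_mul h3 h6 h7 h8) ?_
  simp only [dAct_add, dAct_smul, map_add, map_smul, map_neg, smul_eq_mul, zero_smul, add_zero,
    Quaternion.re_neg]
  ring

theorem fderiv_fderiv_weight_mul {n : ℕ} (h : SLH n) (u : HSpace n → ℝ) (q v w : HSpace n)
    (hq : J₁ h q ≠ 0) (hu : ContDiffAt ℝ 2 u (act h q)) :
    fderiv ℝ (fderiv ℝ (fun x => (‖J₁ h x‖ ^ 2)⁻¹ * u (act h x))) q v w =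
      (‖J₁ h q‖ ^ 2)⁻¹ * (fderiv ℝ (fderiv ℝ u) (act h q) (dAct h q v) (dAct h q w) -
        fderiv ℝ u (act h q) (dAct h q ((fun j => v j * logJ h q w) + (fun j => w j * logJ h q v) +
          (2 * (logJ h q v).re) • w + (2 * (logJ h q w).re) • v)) +
        u (act h q) * (2 * (logJ h q v).re * (2 * (logJ h q w).re) +
          2 * (logJ h q v * logJ h q w).re)) := by
  have hd : DifferentiableAt ℝ (fderiv ℝ (fun x => (‖J₁ h x‖ ^ 2)⁻¹ * u (act h x))) q :=
    ((contDiffAt_weight_mul h u q hq hu).fderiv_right (m := 1) (by norm_num)).differentiableAt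
      (by simp)
  have h1 := (hd.clm_apply (differentiableAt_const w)).lineDeriv_eq_fderiv (v := v)
  have h2 : fderiv ℝ (fun x => fderiv ℝ (fun x => (‖J₁ h x‖ ^ 2)⁻¹ * u (act h x)) x w) q v =
      fderiv ℝ (fderiv ℝ (fun x => (‖J₁ h x‖ ^ 2)⁻¹ * u (act h x))) q v w := by
    rw [fderiv_clm_apply hd (differentiableAt_const w)]
    simp
  rw [← h2, ← h1]
  apply HasLineDerivAt.lineDeriv
  -- The first-derivative formula is needed on a neighbourhood, not only at q, in order to be
  -- differentiated again; J ≠ 0 and `C²` are open conditions.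
  have hev : (fun x => fderiv ℝ (fun x => (‖J₁ h x‖ ^ 2)⁻¹ * u (act h x)) x w) =ᶠ[nhds q]
      fun x => (‖J₁ h x‖ ^ 2)⁻¹ * (fderiv ℝ u (act h x) (dAct h x w) -
        2 * (logJ h x w).re * u (act h x)) := by
    filter_upwards [eventually_J₁_ne_zero h q hq,
      (contDiffAt_act h q hq).continuousAt.eventually (hu.eventually (by simp))] with x hx hux
    exact fderiv_weight_mul h u x w hx hux
  exact (hasLineDerivAt_fderiv_weight_mul h u q v w hq hu).congr_of_eventuallyEq hev

/-! ### Complex coordinates on `ℍⁿ` and the algebra of the Baston operator -/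

/-- The complex coordinates of `v ∈ ℍⁿ`: the entries of the `2n × 2` matrix `τ(v)`. -/
def tauVec {n : ℕ} (v : HSpace n) (A : Idx n) (A' : Fin 2) : ℂ := tauScalar (v A.1) A.2 A'

/-- The coefficients of `∇_{AA'}` with respect to `∂/∂x_{4l+s}`. -/
def nablaCoeff (e e' : Fin 2) : Fin 4 → ℂ :=
  !![![1 / 2, Complex.I / 2, 0, 0], ![0, 0, -1 / 2, -Complex.I / 2];
    ![0, 0, 1 / 2, -Complex.I / 2], ![1 / 2, -Complex.I / 2, 0, 0]] e e'

/-- The value of `∇_{AA'}` on the differential `ℓ`. -/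
def nablaForm {n : ℕ} (A : Idx n) (A' : Fin 2) (ℓ : HSpace n → ℂ) : ℂ :=
  ∑ s, nablaCoeff A.2 A' s * ℓ (Pi.single A.1 (unitQ s))

theorem nabla_eq_nablaForm {n : ℕ} (A : Idx n) (A' : Fin 2) (f : HSpace n → ℂ) (q : HSpace n) :
    nabla A A' f q = nablaForm A A' (fderiv ℝ f q) := by
  obtain ⟨l, e⟩ := A
  fin_cases e <;> fin_cases A' <;>
    simp [nabla, nablaForm, nablaCoeff, partialX, Fin.sum_univ_four] <;> ring

section Linearity

variable {n : ℕ} (A : Idx n) (A' : Fin 2)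

theorem nablaForm_add (f g : HSpace n → ℂ) :
    nablaForm A A' (fun v => f v + g v) = nablaForm A A' f + nablaForm A A' g := by
  simp [nablaForm, mul_add, Finset.sum_add_distrib]

theorem nablaForm_sub (f g : HSpace n → ℂ) :
    nablaForm A A' (fun v => f v - g v) = nablaForm A A' f - nablaForm A A' g := by
  simp [nablaForm, mul_sub, Finset.sum_sub_distrib]

theorem nablaForm_const_mul (c : ℂ) (f : HSpace n → ℂ) :
    nablaForm A A' (fun v => c * f v) = c * nablaForm A A' f := by
  simp only [nablaForm, Finset.mul_sum]
  exact Finset.sum_congr rfl fun _ _ => by ring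

theorem nablaForm_mul_const (c : ℂ) (f : HSpace n → ℂ) :
    nablaForm A A' (fun v => f v * c) = nablaForm A A' f * c := by
  simp only [mul_comm _ c, nablaForm_const_mul]

theorem nablaForm_sum {κ : Type*} (s : Finset κ) (f : κ → HSpace n → ℂ) :
    nablaForm A A' (fun v => ∑ i ∈ s, f i v) = ∑ i ∈ s, nablaForm A A' (f i) := by
  simp only [nablaForm, Finset.mul_sum]
  exact Finset.sum_comm

theorem nablaForm_comm (B : Idx n) (B' : Fin 2) (H : HSpace n → HSpace n → ℂ) :
    nablaForm A A' (fun v => nablaForm B B' (H v)) =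
      nablaForm B B' (fun w => nablaForm A A' (fun v => H v w)) := by
  simp only [nablaForm, Finset.mul_sum]
  rw [Finset.sum_comm]
  exact Finset.sum_congr rfl fun _ _ => Finset.sum_congr rfl fun _ _ => by ring

/-- The factor 1/2 and the signs in ∇_{AA'} make it the dual basis to the complex coordinates
τ(v)_{AA'}; all later computations use only this duality. -/
theorem nablaForm_tauVec (B : Idx n) (B' : Fin 2) :
    nablaForm A A' (fun v => tauVec v B B') =
      (if B = A then 1 else 0) * (if B' = A' then 1 else 0) := by
  obtain ⟨l, e⟩ := A
  obtain ⟨m, f⟩ := B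
  by_cases h : m = l
  · subst h
    fin_cases e <;> fin_cases f <;> fin_cases A' <;> fin_cases B' <;>
      simp [nablaForm, nablaCoeff, tauVec, tauScalar, unitQ, Fin.sum_univ_four] <;>
      ring_nf <;> simp <;> norm_num
  · simp [nablaForm, tauVec, h]

end Linearity

theorem eq_sum_nablaForm {n : ℕ} (ℓ : HSpace n →ₗ[ℝ] ℂ) (v : HSpace n) :
    ℓ v = ∑ A, ∑ A', nablaForm A A' ℓ * tauVec v A A' := by
  have h1 : ∀ l, Pi.single l (v l) = ∑ s : Fin 4,
      (![(v l).re, (v l).imI, (v l).imJ, (v l).imK] s) • (Pi.single l (unitQ s) : HSpace n) := by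
    intro l
    have h2 : v l = ∑ s : Fin 4, (![(v l).re, (v l).imI, (v l).imJ, (v l).imK] s) • unitQ s := by
      ext <;> simp [Fin.sum_univ_four] <;> simp [unitQ]
    conv_lhs => rw [h2]
    simp [Fin.sum_univ_four, Pi.single_add, Pi.single_smul]
  conv_lhs => rw [← Finset.univ_sum_single v]
  simp only [h1, map_sum, map_smul, Fintype.sum_prod_type]
  refine Finset.sum_congr rfl fun l _ => ?_
  simp [Fin.sum_univ_four, Fin.sum_univ_two, nablaForm, nablaCoeff, tauVec, tauScalar]
  ring_nf
  simp

/-! ### The Grassmann element attached to a bilinear form. -/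

/-- The Grassmann variable `ω^A`. -/
def omegaVar {n : ℕ} (A : Idx n) : Grassmann n := ExteriorAlgebra.ι ℂ (Pi.single A 1)

theorem omegaVar_mul_comm {n : ℕ} (A B : Idx n) :
    omegaVar A * omegaVar B = -(omegaVar B * omegaVar A) :=
  eq_neg_of_add_eq_zero_left (ExteriorAlgebra.ι_add_mul_swap _ _)

/-- `∑ H_{AA',BB'} ω^A ω^B` for a bilinear form `H` on `ℍⁿ`. -/
def bastonForm {n : ℕ} (A' B' : Fin 2) (H : HSpace n → HSpace n → ℂ) : Grassmann n :=
  ∑ A, ∑ B, nablaForm A A' (fun v => nablaForm B B' (H v)) • (omegaVar A * omegaVar B)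

theorem sum_symm_smul_eq_neg {n : ℕ} (k l : Idx n → Idx n → ℂ) (h : ∀ A B, k A B = l B A) :
    ∑ A, ∑ B, k A B • (omegaVar A * omegaVar B) =
      -∑ A, ∑ B, l A B • (omegaVar A * omegaVar B) := by
  rw [Finset.sum_comm]
  simp only [← Finset.sum_neg_distrib]
  refine Finset.sum_congr rfl fun A _ => Finset.sum_congr rfl fun B _ => ?_
  rw [h, omegaVar_mul_comm B A, smul_neg]

theorem sum_symm_smul_eq_zero {n : ℕ} (k : Idx n → Idx n → ℂ) (h : ∀ A B, k A B = k B A) :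
    ∑ A, ∑ B, k A B • (omegaVar A * omegaVar B) = 0 := by
  have h1 := sum_symm_smul_eq_neg k k h
  rw [eq_neg_iff_add_eq_zero, ← two_smul ℂ] at h1
  exact (smul_eq_zero_iff_right (two_ne_zero' ℂ)).1 h1

theorem bastonForm_swap {n : ℕ} (A' B' : Fin 2) (H : HSpace n → HSpace n → ℂ)
    (hH : ∀ v w, H v w = H w v) : bastonForm A' B' H = -bastonForm B' A' H := by
  refine sum_symm_smul_eq_neg _ _ fun A B => ?_
  rw [nablaForm_comm]
  simp only [hH]

theorem bastonForm_self {n : ℕ} (A' : Fin 2) (H : HSpace n → HSpace n → ℂ)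
    (hH : ∀ v w, H v w = H w v) : bastonForm A' A' H = 0 := by
  refine sum_symm_smul_eq_zero _ fun A B => ?_
  rw [nablaForm_comm]
  simp only [hH]

/-- Reduces △u at a point to linear algebra on the real Hessian. -/
theorem baston_eq_bastonForm {n : ℕ} (u : HSpace n → ℝ) (q : HSpace n) (hu : ContDiffAt ℝ 2 u q) :
    baston u q = bastonForm 0 1 (fun v w => (fderiv ℝ (fderiv ℝ u) q v w : ℂ)) := by
  have h1 : ∀ x, ContDiffAt ℝ 2 u x → ∀ w,
      fderiv ℝ (fun y => (u y : ℂ)) x w = (fderiv ℝ u x w : ℂ) := fun x hx w => by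
    have := (Complex.ofRealCLM.hasFDerivAt (x := u x)).comp x
      (hx.differentiableAt (by simp)).hasFDerivAt
    exact congrArg (fun L => L w) this.fderiv
  have hd : DifferentiableAt ℝ (fderiv ℝ u) q :=
    (hu.fderiv_right (m := 1) (by norm_num)).differentiableAt (by simp)
  have h2 : ∀ A B : Idx n, nabla A 0 (nabla B 1 fun y => (u y : ℂ)) q =
      nablaForm A 0 (fun v => nablaForm B 1 fun w => (fderiv ℝ (fderiv ℝ u) q v w : ℂ)) := by
    intro A B
    have hev : nabla B 1 (fun y => (u y : ℂ)) =ᶠ[nhds q]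
        fun x => nablaForm B 1 (fun w => (fderiv ℝ u x w : ℂ)) := by
      filter_upwards [hu.eventually (by simp)] with x hx
      rw [nabla_eq_nablaForm]
      congr 1
      ext1 w
      exact h1 x hx w
    rw [nabla_eq_nablaForm, hev.fderiv_eq]
    congr 1
    ext1 v
    have h3 : ∀ w, HasFDerivAt (fun x => (fderiv ℝ u x w : ℂ))
        (Complex.ofRealCLM.comp ((fderiv ℝ (fderiv ℝ u) q).flip w)) q := fun w => by
      have h4 := hd.hasFDerivAt.clm_apply (hasFDerivAt_const w q)
      have h5 := (Complex.ofRealCLM.hasFDerivAt (x := fderiv ℝ u q w)).comp q h4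
      exact h5.congr_fderiv (by ext1 v; simp)
    have h4 := HasFDerivAt.fun_sum fun s (_ : s ∈ Finset.univ) =>
      (h3 (Pi.single B.1 (unitQ s))).const_mul (nablaCoeff B.2 1 s)
    have h5 := congrArg (fun L => L v) h4.fderiv
    refine h5.trans ?_
    simp [nablaForm]
  unfold baston FormField.value bastonForm
  -- Multi-indices of length two become pairs (A, B).
  rw [← (finTwoArrowEquiv (Idx n)).symm.sum_comp, Fintype.sum_prod_type]
  refine Finset.sum_congr rfl fun A _ => Finset.sum_congr rfl fun B _ => ?_
  rw [← h2]
  congr 1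
  simp [ExteriorAlgebra.ιMulti_apply, omegaVar, Matrix.vecTail]

/-! ### The terms of the transformed Hessian in complex coordinates. -/

theorem two_mul_re_eq_trace (p : ℍ[ℝ]) : 2 * (p.re : ℂ) = tauScalar p 0 0 + tauScalar p 1 1 := by
  simp [tauScalar]
  ring

theorem tau_apply {n : ℕ} (D : Matrix (Fin n) (Fin n) ℍ[ℝ]) (A B : Idx n) :
    tau n D A B = tauScalar (D A.1 B.1) A.2 B.2 := rfl

theorem tauScalar_sum_mul {n : ℕ} (p : Fin n → ℍ[ℝ]) (v : HSpace n) (i j : Fin 2) :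
    tauScalar (∑ l, p l * v l) i j = ∑ A : Idx n, tauScalar (p A.1) i A.2 * tauVec v A j := by
  simp only [map_sum, map_mul, Matrix.sum_apply, Matrix.mul_apply, Fintype.sum_prod_type, tauVec]

theorem tauScalar_logJ {n : ℕ} (h : SLH n) (q w : HSpace n) (i j : Fin 2) :
    tauScalar (logJ h q w) i j =
      ∑ B : Idx n, tauScalar ((J₁ h q)⁻¹ * entry h 0 B.1.succ) i B.2 * tauVec w B j := by
  rw [← tauScalar_sum_mul fun l => (J₁ h q)⁻¹ * entry h 0 (Fin.succ l)]
  simp only [logJ, linJ, Finset.mul_sum, mul_assoc]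

theorem tauVec_dAct {n : ℕ} (h : SLH n) (q v : HSpace n) (A : Idx n) (A' : Fin 2) :
    tauVec (dAct h q v) A A' = ∑ B', ∑ B, tau n (actMatrix h q) A B * tauVec v B B' *
      tauScalar (J₁ h q)⁻¹ B' A' := by
  simp only [tauVec, dAct]
  rw [map_mul, Matrix.mul_apply]
  simp only [tauScalar_sum_mul, tau_apply, Finset.sum_mul, tauVec]

/-- Since L multiplies v from the left, column j of τ(L(v)) involves only column j of τ(v). With β
the matrix of L, the result is β_{iA}δ_{jA'}. -/
theorem nablaForm_tauScalar_logJ {n : ℕ} (h : SLH n) (q : HSpace n) (i j : Fin 2) (A : Idx n)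
    (A' : Fin 2) : nablaForm A A' (fun v => tauScalar (logJ h q v) i j) =
      tauScalar ((J₁ h q)⁻¹ * entry h 0 A.1.succ) i A.2 * (if j = A' then 1 else 0) := by
  simp only [tauScalar_logJ, nablaForm_sum, nablaForm_const_mul, nablaForm_tauVec]
  simp

/-- The derivative of `q ↦ h.q` as a real linear map. -/
def dActLin {n : ℕ} (h : SLH n) (q : HSpace n) : HSpace n →ₗ[ℝ] HSpace n where
  toFun := dAct h q
  map_add' := dAct_add h q
  map_smul' := dAct_smul h q

theorem nablaForm_comp_dAct {n : ℕ} (h : SLH n) (q : HSpace n) (ℓ : HSpace n →ₗ[ℝ] ℂ) (A : Idx n)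
    (A' : Fin 2) : nablaForm A A' (fun v => ℓ (dAct h q v)) =
      ∑ B, ∑ B', nablaForm B B' ℓ *
        (tau n (actMatrix h q) B A * tauScalar (J₁ h q)⁻¹ A' B') := by
  simp only [eq_sum_nablaForm ℓ (dAct h q _), nablaForm_sum, nablaForm_const_mul, tauVec_dAct,
    nablaForm_mul_const, nablaForm_tauVec]
  simp

/-- `∇_{BB'}` applied to the second argument of a bilinear form. -/
def nablaFormRight {n : ℕ} (B : Idx n) (B' : Fin 2) (K : HSpace n →ₗ[ℝ] HSpace n →ₗ[ℝ] ℂ) :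
    HSpace n →ₗ[ℝ] ℂ where
  toFun v := nablaForm B B' (K v)
  map_add' v w := by
    rw [← nablaForm_add, map_add]
    rfl
  map_smul' r v := by
    rw [RingHom.id_apply, Complex.real_smul, ← nablaForm_const_mul, map_smul]
    simp only [← Complex.real_smul]
    rfl

/-- The action of `τ(D)` on the Grassmann variables, `ω^C ↦ τ(D)_{CA} ω^A`. -/
def grassmannMap {n : ℕ} (D : Matrix (Fin n) (Fin n) ℍ[ℝ]) : Grassmann n →ₐ[ℂ] Grassmann n :=
  ExteriorAlgebra.map (Matrix.toLin' (tau n D).transpose)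

theorem grassmannMap_omegaVar {n : ℕ} (D : Matrix (Fin n) (Fin n) ℍ[ℝ]) (C : Idx n) :
    grassmannMap D (omegaVar C) = ∑ A, tau n D C A • omegaVar A := by
  rw [grassmannMap, omegaVar, ExteriorAlgebra.map_apply_ι]
  simp only [omegaVar, ← map_smul, ← map_sum]
  congr 1
  ext A
  simp [Finset.sum_apply, Pi.single_apply]

theorem tauScalar_det (p : ℍ[ℝ]) : (tauScalar p).det = ((‖p‖ ^ 2 : ℝ) : ℂ) := by
  rw [sq, ← Quaternion.normSq_eq_norm_mul_self, Quaternion.normSq_def', Matrix.det_fin_two]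
  simp [tauScalar]
  ring_nf
  simp
  ring

theorem sum_sum_comm_sum_sum {κ M : Type*} [Fintype κ] [AddCommMonoid M]
    (f : κ → κ → κ → κ → M) :
    ∑ a, ∑ b, ∑ c, ∑ d, f a b c d = ∑ c, ∑ d, ∑ a, ∑ b, f a b c d := by
  simpa only [Fintype.sum_prod_type] using
    Finset.sum_comm (s := Finset.univ) (t := Finset.univ)
      (f := fun (x y : κ × κ) => f x.1 x.2 y.1 y.2)

/-- For symmetric K the element attached to (G', F') is alternating in the primed indices, so
transforming these by τ(J⁻¹) only produces its determinant |J|⁻². -/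
theorem bastonForm_comp_dAct {n : ℕ} (h : SLH n) (q : HSpace n)
    (K : HSpace n →ₗ[ℝ] HSpace n →ₗ[ℝ] ℂ) (hK : ∀ v w, K v w = K w v) :
    bastonForm 0 1 (fun v w => K (dAct h q v) (dAct h q w)) =
      (((‖J₁ h q‖ ^ 2)⁻¹ : ℝ) : ℂ) •
        grassmannMap (actMatrix h q) (bastonForm 0 1 (fun v w => K v w)) := by
  have h1 : ∀ A B : Idx n,
      nablaForm A 0 (fun v => nablaForm B 1 (fun w => K (dAct h q v) (dAct h q w))) =
      ∑ F', ∑ G', tauScalar (J₁ h q)⁻¹ 0 G' * tauScalar (J₁ h q)⁻¹ 1 F' * ∑ G, ∑ F,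
        nablaForm G G' (fun v => nablaForm F F' (K v)) *
          (tau n (actMatrix h q) G A * tau n (actMatrix h q) F B) := by
    intro A B
    have h2 : ∀ (F : Idx n) (F' : Fin 2), nablaForm A 0 (fun v => nablaForm F F' (K (dAct h q v))) =
        _ := fun F F' => nablaForm_comp_dAct h q (nablaFormRight F F' K) A 0
    simp only [nablaForm_comp_dAct, nablaForm_sum, nablaForm_mul_const, h2]
    rw [Finset.sum_comm]
    refine Finset.sum_congr rfl fun F' _ => ?_
    simp only [Finset.mul_sum, Finset.sum_mul]
    rw [Finset.sum_congr rfl fun F _ => Finset.sum_comm, Finset.sum_comm]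
    refine Finset.sum_congr rfl fun G' _ => ?_
    rw [Finset.sum_comm]
    refine Finset.sum_congr rfl fun G _ => Finset.sum_congr rfl fun F _ => ?_
    simp only [nablaFormRight, LinearMap.coe_mk, AddHom.coe_mk]
    ring
  have h3 : ∀ G' F' : Fin 2, grassmannMap (actMatrix h q) (bastonForm G' F' fun v w => K v w) =
      ∑ A, ∑ B, (∑ G, ∑ F, nablaForm G G' (fun v => nablaForm F F' (K v)) *
          (tau n (actMatrix h q) G A * tau n (actMatrix h q) F B)) • (omegaVar A * omegaVar B) := by
    intro G' F'
    simp only [bastonForm, map_sum, map_smul, map_mul, grassmannMap_omegaVar, Finset.sum_mul_sum,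
      Finset.smul_sum, Finset.sum_smul, smul_mul_smul_comm, smul_smul]
    exact sum_sum_comm_sum_sum _
  have h4 : bastonForm 0 1 (fun v w => K (dAct h q v) (dAct h q w)) =
      ∑ F', ∑ G', (tauScalar (J₁ h q)⁻¹ 0 G' * tauScalar (J₁ h q)⁻¹ 1 F') •
        grassmannMap (actMatrix h q) (bastonForm G' F' fun v w => K v w) := by
    simp only [h3]
    simp only [bastonForm, h1, Finset.smul_sum, smul_smul, Fin.sum_univ_two,
      Finset.sum_add_distrib, add_smul]
  rw [h4]
  -- The terms with G' = F' vanish; the two others differ by a sign and assemble the 2 × 2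
  -- determinant.
  simp only [Fin.sum_univ_two, bastonForm_self _ _ hK, bastonForm_swap 1 0 _ hK, map_zero, map_neg,
    smul_zero, zero_add, add_zero, smul_neg]
  rw [← inv_pow, ← norm_inv, ← tauScalar_det, Matrix.det_fin_two, sub_smul, sub_eq_neg_add,
    mul_comm (tauScalar (J₁ h q)⁻¹ 0 1)]

theorem tauVec_add {n : ℕ} (v w : HSpace n) (A : Idx n) (A' : Fin 2) :
    tauVec (v + w) A A' = tauVec v A A' + tauVec w A A' := by
  simp only [tauVec, Pi.add_apply, map_add, Matrix.add_apply]

theorem tauVec_smul {n : ℕ} (r : ℝ) (v : HSpace n) (A : Idx n) (A' : Fin 2) :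
    tauVec (r • v) A A' = r * tauVec v A A' := by
  obtain ⟨l, e⟩ := A
  fin_cases e <;> fin_cases A' <;> simp [tauVec, tauScalar] <;> ring

theorem tauVec_mul {n : ℕ} (v : HSpace n) (p : ℍ[ℝ]) (A : Idx n) (A' : Fin 2) :
    tauVec (fun j => v j * p) A A' = ∑ i, tauVec v A i * tauScalar p i A' := by
  simp only [tauVec, map_mul, Matrix.mul_apply]

/-- With β as the matrix of L, the component C' = 1' of the argument gives δ_{CA}β_{0B} +
δ_{CB}β_{0A}, and C' = 0' gives δ_{CB}β_{1A} + δ_{CA}β_{1B}. In each, one summand comes from the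
action and one from the weight; the sum is symmetric in A, B. -/
theorem bastonForm_gradient_term {n : ℕ} (h : SLH n) (q : HSpace n) (ℓ : HSpace n →ₗ[ℝ] ℂ) :
    bastonForm 0 1 (fun v w => ℓ ((fun j => v j * logJ h q w) + (fun j => w j * logJ h q v) +
      (2 * (logJ h q v).re) • w + (2 * (logJ h q w).re) • v)) = 0 := by
  refine sum_symm_smul_eq_zero _ fun A B => ?_
  simp only [eq_sum_nablaForm ℓ (_ + _), nablaForm_sum, nablaForm_const_mul, tauVec_add,
    tauVec_smul, tauVec_mul, nablaForm_add, nablaForm_mul_const, nablaForm_tauVec,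
    Complex.ofReal_mul, Complex.ofReal_ofNat, two_mul_re_eq_trace, nablaForm_tauScalar_logJ,
    Fin.sum_univ_two]
  simp [mul_add, Finset.sum_add_distrib]
  ring

/-- The product of traces gives β_{0A}β_{1B}, and the trace of the product gives β_{1A}β_{0B}; the
sum is symmetric in A, B. -/
theorem bastonForm_value_term {n : ℕ} (h : SLH n) (q : HSpace n) :
    bastonForm 0 1 (fun v w => (2 * (logJ h q v).re * (2 * (logJ h q w).re) +
      2 * (logJ h q v * logJ h q w).re : ℂ)) = 0 := by
  refine sum_symm_smul_eq_zero _ fun A B => ?_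
  simp only [two_mul_re_eq_trace, map_mul, Matrix.mul_apply, nablaForm_add, nablaForm_const_mul,
    nablaForm_mul_const, nablaForm_tauScalar_logJ, Fin.sum_univ_two]
  simp
  ring

theorem bastonForm_add {n : ℕ} (A' B' : Fin 2) (H K : HSpace n → HSpace n → ℂ) :
    bastonForm A' B' (fun v w => H v w + K v w) = bastonForm A' B' H + bastonForm A' B' K := by
  simp only [bastonForm, nablaForm_add, add_smul, Finset.sum_add_distrib]

theorem bastonForm_sub {n : ℕ} (A' B' : Fin 2) (H K : HSpace n → HSpace n → ℂ) :
    bastonForm A' B' (fun v w => H v w - K v w) = bastonForm A' B' H - bastonForm A' B' K := by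
  simp only [bastonForm, nablaForm_sub, sub_smul, Finset.sum_sub_distrib]

theorem bastonForm_const_mul {n : ℕ} (A' B' : Fin 2) (c : ℂ) (H : HSpace n → HSpace n → ℂ) :
    bastonForm A' B' (fun v w => c * H v w) = c • bastonForm A' B' H := by
  simp only [bastonForm, nablaForm_const_mul, Finset.smul_sum, smul_smul]

theorem baston_weight_mul {n : ℕ} (h : SLH n) (u : HSpace n → ℝ) (q : HSpace n)
    (hq : J₁ h q ≠ 0) (hu : ContDiffAt ℝ 2 u (act h q)) :
    baston (fun x => (‖J₁ h x‖ ^ 2)⁻¹ * u (act h x)) q =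
      ((((‖J₁ h q‖ ^ 2)⁻¹) ^ 2 : ℝ) : ℂ) •
        grassmannMap (actMatrix h q) (baston u (act h q)) := by
  rw [baston_eq_bastonForm _ _ (contDiffAt_weight_mul h u q hq hu), baston_eq_bastonForm u _ hu]
  simp only [fderiv_fderiv_weight_mul h u q _ _ hq hu]
  let K : HSpace n →ₗ[ℝ] HSpace n →ₗ[ℝ] ℂ :=
    LinearMap.mk₂ ℝ (fun v w => (fderiv ℝ (fderiv ℝ u) (act h q) v w : ℂ))
      (by simp) (by simp) (by simp) (by simp)
  let ℓ : HSpace n →ₗ[ℝ] ℂ :=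
    (Complex.ofRealCLM.comp (fderiv ℝ u (act h q))).toLinearMap.comp (dActLin h q)
  have hK : ∀ v w, K v w = K w v := fun v w => by
    have := (hu.isSymmSndFDerivAt (by simp)).eq v w
    simp [K, this]
  have h1 := bastonForm_comp_dAct h q K hK
  have h2 := bastonForm_gradient_term h q ℓ
  have h3 := bastonForm_value_term h q
  simp only [Complex.ofReal_mul, Complex.ofReal_add, Complex.ofReal_sub, bastonForm_const_mul,
    bastonForm_add, bastonForm_sub, Complex.ofReal_ofNat]
  simp only [K, ℓ, LinearMap.mk₂_apply, LinearMap.comp_apply, ContinuousLinearMap.coe_coe,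
    ContinuousLinearMap.comp_apply, Complex.ofRealCLM_apply, dActLin, LinearMap.coe_mk,
    AddHom.coe_mk] at h1 h2
  rw [h1, h2]
  rw [bastonForm_add, bastonForm_const_mul] at h3
  rw [h3, smul_zero, sub_zero, add_zero, smul_smul, ← Complex.ofReal_mul, ← sq]

/-! ### Determinants -/

/-- Splitting off the first `2` of the `2n + 2` complex coordinates. -/
def splitIdx (n : ℕ) : Fin 2 ⊕ Idx n ≃ Idx (n + 1) where
  toFun := Sum.elim (fun e => (0, e)) fun A => (A.1.succ, A.2)
  invFun A := Fin.cases (motive := fun _ => Fin 2 ⊕ Idx n) (Sum.inl A.2)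
    (fun i => Sum.inr (i, A.2)) A.1
  left_inv x := by rcases x with e | ⟨i, e⟩ <;> rfl
  right_inv A := by
    obtain ⟨i, e⟩ := A
    cases i using Fin.cases <;> rfl

theorem tau_submatrix_splitIdx {n : ℕ} (M : Matrix (Fin (n + 1)) (Fin (n + 1)) ℍ[ℝ]) :
    (tau (n + 1) M).submatrix (splitIdx n) (splitIdx n) = Matrix.fromBlocks (tauScalar (M 0 0))
      (Matrix.of fun e A => tauScalar (M 0 A.1.succ) e A.2)
      (Matrix.of fun A e => tauScalar (M A.1.succ 0) A.2 e)
      (tau n (M.submatrix Fin.succ Fin.succ)) := by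
  ext A B
  rcases A with e | A <;> rcases B with f | B <;> rfl

theorem det_tau_of_col_eq_zero {n : ℕ} (M : Matrix (Fin (n + 1)) (Fin (n + 1)) ℍ[ℝ])
    (hM : ∀ i : Fin n, M i.succ 0 = 0) : (tau (n + 1) M).det =
      (tauScalar (M 0 0)).det * (tau n (M.submatrix Fin.succ Fin.succ)).det := by
  have h0 : (Matrix.of fun (A : Idx n) e => tauScalar (M A.1.succ 0) A.2 e) = 0 := by
    ext A e
    simp [hM]
  rw [← Matrix.det_submatrix_equiv_self (splitIdx n), tau_submatrix_splitIdx, h0,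
    Matrix.det_fromBlocks_zero₂₁]

theorem det_tau_of_row_eq_zero {n : ℕ} (M : Matrix (Fin (n + 1)) (Fin (n + 1)) ℍ[ℝ])
    (hM : ∀ i : Fin n, M 0 i.succ = 0) : (tau (n + 1) M).det =
      (tauScalar (M 0 0)).det * (tau n (M.submatrix Fin.succ Fin.succ)).det := by
  have h0 : (Matrix.of fun e (A : Idx n) => tauScalar (M 0 A.1.succ) e A.2) = 0 := by
    ext e A
    simp [hM]
  rw [← Matrix.det_submatrix_equiv_self (splitIdx n), tau_submatrix_splitIdx, h0,
    Matrix.det_fromBlocks_zero₁₂]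

/-- The unipotent matrix `(1 0; v 1)`. -/
def lowerUnipotent {n : ℕ} (v : HSpace n) : Matrix (Fin (n + 1)) (Fin (n + 1)) ℍ[ℝ] :=
  Matrix.of (Fin.cons (Fin.cons 1 0) fun i => Fin.cons (v i) (Pi.single i 1))

theorem det_tau_lowerUnipotent {n : ℕ} (v : HSpace n) :
    (tau (n + 1) (lowerUnipotent v)).det = 1 := by
  have h1 : (lowerUnipotent v).submatrix Fin.succ Fin.succ = 1 := by
    ext1 i j
    simp [lowerUnipotent, Matrix.one_apply, Pi.single_apply, eq_comm]
  rw [det_tau_of_row_eq_zero _ fun i => by simp [lowerUnipotent], h1]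
  simp [lowerUnipotent]

theorem det_tau_actMatrix {n : ℕ} (h : SLH n) (q : HSpace n) (hq : J₁ h q ≠ 0) :
    (tau n (actMatrix h q)).det = (((‖J₁ h q‖ ^ 2)⁻¹ : ℝ) : ℂ) := by
  let H : Matrix (Fin (n + 1)) (Fin (n + 1)) ℍ[ℝ] := Matrix.of (entry h)
  have hH : (tau (n + 1) H).det = 1 := h.2
  -- The right factor turns the first column of h into (J, c + dq); the left one then subtracts
  -- (h.q)J = c + dq and leaves D as the lower right block.
  let M := lowerUnipotent (-act h q) * H * lowerUnipotent q
  have hM : (tau (n + 1) M).det = 1 := by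
    simp only [M, map_mul, Matrix.det_mul, det_tau_lowerUnipotent, hH, one_mul]
  have h00 : M 0 0 = J₁ h q := by
    simp [M, H, J₁, lowerUnipotent, Matrix.mul_apply, Fin.sum_univ_succ]
  have hcol : ∀ i : Fin n, M i.succ 0 = 0 := by
    intro i
    have h1 : act h q i * J₁ h q =
        entry h i.succ 0 + ∑ j : Fin n, entry h i.succ j.succ * q j := by
      simp [act, mul_assoc, inv_mul_cancel₀ hq]
    have h2 : M i.succ 0 = -(act h q i * J₁ h q) +
        (entry h i.succ 0 + ∑ j : Fin n, entry h i.succ j.succ * q j) := by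
      simp [M, H, J₁, lowerUnipotent, Matrix.mul_apply, Fin.sum_univ_succ, Pi.single_apply,
        mul_add, Finset.sum_add_distrib, Finset.mul_sum, mul_assoc]
      abel
    rw [h2, h1, neg_add_cancel]
  have hsub : M.submatrix Fin.succ Fin.succ = actMatrix h q := by
    ext1 i j
    simp [M, H, lowerUnipotent, Matrix.mul_apply, Fin.sum_univ_succ, Pi.single_apply, actMatrix]
    abel
  rw [det_tau_of_col_eq_zero M hcol, h00, hsub, tauScalar_det] at hM
  rw [Complex.ofReal_inv]
  exact eq_inv_of_mul_eq_one_right hM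

/-- Top exterior degree is the line spanned by `Omega n`, on which L acts by its determinant. -/
theorem topCoeff_map {n : ℕ} (L : (Idx n → ℂ) →ₗ[ℂ] (Idx n → ℂ)) (x : Grassmann n)
    (hx : x ∈ ⋀[ℂ]^(n * 2) (Idx n → ℂ)) :
    topCoeff n (ExteriorAlgebra.map L x) = LinearMap.det L * topCoeff n x := by
  rw [exteriorPower_top_eq n x hx, map_smul, Omega, ExteriorAlgebra.map_apply_ιMulti,
    ιMulti_eq_smul_Omega, Module.Basis.det_comp, Module.Basis.det_self, ← Omega]
  simp only [map_smul, topCoeff_Omega, smul_eq_mul, mul_one]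
  ring

/-! ### The transformation law -/

theorem mongeAmpere_weightedAct {n : ℕ} (g : SLH n) (u : HSpace n → ℝ) (q : HSpace n)
    (hq : J₁ g⁻¹ q ≠ 0) (hu : ContDiffAt ℝ 2 u (act g⁻¹ q)) :
    mongeAmpere (weightedAct g u) q =
      ((‖J₁ g⁻¹ q‖ ^ (4 * n + 2))⁻¹ : ℝ) * mongeAmpere u (act g⁻¹ q) := by
  have hmem : baston u (act g⁻¹ q) ^ n ∈ ⋀[ℂ]^(n * 2) (Idx n → ℂ) := by
    rw [baston_pow_eq]
    exact Submodule.smul_mem _ _ (ExteriorAlgebra.ιMulti_range ℂ (n * 2) (Set.mem_range_self _))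
  have h1 : baston (weightedAct g u) q = _ := baston_weight_mul g⁻¹ u q hq hu
  rw [mongeAmpere, h1, smul_pow, ← map_pow, map_smul, grassmannMap, topCoeff_map _ _ hmem,
    LinearMap.det_toLin', Matrix.det_transpose, det_tau_actMatrix _ _ hq, mongeAmpere, smul_eq_mul,
    ← mul_assoc, ← Complex.ofReal_pow, ← Complex.ofReal_mul]
  congr 2
  -- The exponent is 4n from the n-th power of |J|⁻⁴, plus 2 from det τ(D).
  simp only [inv_pow, ← mul_inv, ← pow_mul, ← pow_add]

theorem mongeAmpere_div_weightedAct {n : ℕ} (g : SLH n) (u : HSpace n → ℝ) (q : HSpace n)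
    (hq : J₁ g⁻¹ q ≠ 0) (hu : ContDiffAt ℝ 2 u (act g⁻¹ q)) :
    mongeAmpere (weightedAct g u) q / (weightedAct g u q : ℂ) ^ (2 * n + 1) =
      mongeAmpere u (act g⁻¹ q) / (u (act g⁻¹ q) : ℂ) ^ (2 * n + 1) := by
  have h1 : (((‖J₁ g⁻¹ q‖ ^ (4 * n + 2))⁻¹ : ℝ) : ℂ) ≠ 0 := by simpa using hq
  have h2 : (weightedAct g u q : ℂ) ^ (2 * n + 1) =
      ((‖J₁ g⁻¹ q‖ ^ (4 * n + 2))⁻¹ : ℝ) * (u (act g⁻¹ q) : ℂ) ^ (2 * n + 1) := by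
    rw [weightedAct, Complex.ofReal_mul, mul_pow, ← Complex.ofReal_pow, inv_pow, ← pow_mul]
    congr 4
    ring
  rw [mongeAmpere_weightedAct g u q hq hu, h2, mul_div_mul_left _ _ h1]

/-! ### Locality of △ and gluing over the manifold. -/

theorem baston_congr {n : ℕ} {u v : HSpace n → ℝ} {q : HSpace n} (h : u =ᶠ[nhds q] v) :
    baston u q = baston v q := by
  have hn : ∀ (A : Idx n) (A' : Fin 2) {f g : HSpace n → ℂ}, f =ᶠ[nhds q] g →
      nabla A A' f =ᶠ[nhds q] nabla A A' g := fun A A' f g hfg => by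
    filter_upwards [hfg.eventuallyEq_nhds] with x hx
    rw [nabla_eq_nablaForm, nabla_eq_nablaForm, hx.fderiv_eq]
  have hc : (fun x => (u x : ℂ)) =ᶠ[nhds q] fun x => (v x : ℂ) :=
    h.fun_comp (fun r : ℝ => (r : ℂ))
  unfold baston FormField.value
  refine Finset.sum_congr rfl fun I _ => ?_
  congr 1
  exact (hn _ _ (hn _ _ hc)).eq_of_nhds

theorem FlatStructure.DensitySection.mongeAmpere_div_eq {n : ℕ} {M : Type*} [TopologicalSpace M]
    {ι : Type*} {X : FlatStructure n M ι} (u : X.DensitySection) (α β : ι) (p : M)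
    (hα : p ∈ (X.chart α).source) (hβ : p ∈ (X.chart β).source) :
    mongeAmpere (u.loc α) (X.chart α p) / (u.loc α (X.chart α p) : ℂ) ^ (2 * n + 1) =
      mongeAmpere (u.loc β) (X.chart β p) / (u.loc β (X.chart β p) : ℂ) ^ (2 * n + 1) := by
  obtain ⟨hJ, hact⟩ := X.transition α β p hα hβ
  -- △ sees the germ of the function, so the gluing relation is needed near the point; it holds on
  -- the open image of the chart overlap.
  have hev : u.loc α =ᶠ[nhds (X.chart α p)] weightedAct (X.trans α β) (u.loc β) := by
    have h1 : ∀ᶠ x in nhds (X.chart α p), (X.chart α).symm x ∈ (X.chart β).source :=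
      ((X.chart α).continuousAt_symm ((X.chart α).map_source hα)).eventually
        (by
          rw [(X.chart α).left_inv hα]
          exact (X.chart β).open_source.mem_nhds hβ)
    filter_upwards [h1, (X.chart α).open_target.mem_nhds ((X.chart α).map_source hα)] with x hx hxt
    simpa only [(X.chart α).right_inv hxt] using
      u.glue α β ((X.chart α).symm x) ((X.chart α).map_target hxt) hx
  have hu : ContDiffAt ℝ 2 (u.loc β) (act (X.trans α β)⁻¹ (X.chart α p)) := by
    rw [← hact]
    exact (u.contDiffOn β).contDiffAt ((X.chart β).open_target.mem_nhds ((X.chart β).map_source hβ))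
  rw [mongeAmpere, baston_congr hev, hev.eq_of_nhds, ← mongeAmpere,
    mongeAmpere_div_weightedAct _ _ _ hJ hu, ← hact]

end QuatProj

end

open QuatProj in
theorem mainTheorem5 (n : ℕ) :
    -- transformation law of `M`, and invariance of `M(u) / u^{2n+1}`, under the weighted action
    (∀ (g : SLH n) (u : HSpace n → ℝ) (q : HSpace n),
      J₁ g⁻¹ q ≠ 0 → ContDiffAt ℝ 2 u (act g⁻¹ q) →
        mongeAmpere (weightedAct g u) q =
            ((‖J₁ g⁻¹ q‖ ^ (4 * n + 2))⁻¹ : ℝ) * mongeAmpere u (act g⁻¹ q) ∧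
        (u (act g⁻¹ q) ≠ 0 →
          mongeAmpere (weightedAct g u) q / (weightedAct g u q : ℂ) ^ (2 * n + 1) =
            mongeAmpere u (act g⁻¹ q) / (u (act g⁻¹ q) : ℂ) ^ (2 * n + 1))) ∧
    -- for a section `u` of `ℝ[-1]` on a flat manifold, the local expressions `M(u) / u^{2n+1}`
    -- define one function on the set where `u` does not vanish
    (∀ (M : Type*) [TopologicalSpace M] (ι : Type*) (X : FlatStructure n M ι)
      (u : X.DensitySection), ∃ F : M → ℂ, ∀ (α : ι) (p : M), p ∈ (X.chart α).source →
        u.loc α (X.chart α p) ≠ 0 →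
          F p = mongeAmpere (u.loc α) (X.chart α p) /
            (u.loc α (X.chart α p) : ℂ) ^ (2 * n + 1)) := by
  refine ⟨fun g u q hq hu => ⟨mongeAmpere_weightedAct g u q hq hu,
    fun _ => mongeAmpere_div_weightedAct g u q hq hu⟩, fun M _ ι X u => ?_⟩
  -- The global function uses one chosen chart at each point; agreement on overlaps makes the choice
  -- irrelevant.
  choose c hc using X.cover
  exact ⟨fun p => mongeAmpere (u.loc (c p)) (X.chart (c p) p) /
    (u.loc (c p) (X.chart (c p) p) : ℂ) ^ (2 * n + 1), fun α p hp _ =>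
      u.mongeAmpere_div_eq (c p) α p (hc p) hp⟩
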